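/- Let $\sigma:\mathbb R\to\mathbb R$ be Lipschitz, with $\sigma'$ its derivative (set to $0$ at the points, if any, where $\sigma$ is not differentiable). Let $L\ge 2$, fix $\hat{\mathbf x},\mathbf z^{(0)}\in\mathbb R^{n_0}$ with $\|\mathbf z^{(0)}\|_2=1$, and consider a fully connected network with layer widths $n_0,n_1,\dots,n_L$ whose weight matrices $\mathbf W^{(\ell)}\in\mathbb R^{n_{\ell+1}\times n_\ell}$, $0\le\ell\le L-1$, have i.i.d. standard Gaussian entries. Its preactivations at $\hat{\mathbf x}$ are $$\tilde\alpha^{(1)}=\tfrac1{\sqrt{n_0}}\mathbf W^{(0)}\hat{\mathbf x},\qquad \tilde\alpha^{(\ell+1)}=\tfrac1{\sqrt{n_\ell}}\mathbf W^{(\ell)}\sigma(\tilde\alpha^{(\ell)})$$ with $\sigma$ applied entrywise. Put $\mathbf D^{(\ell)}=\mathrm{diag}(\sigma'(\tilde\alpha^{(\ell)}))$ and $$\tilde{\mathbf z}^{(\ell)}=\tfrac1{\sqrt{n_{\ell-1}}}\mathbf W^{(\ell-1)}\mathbf z^{(\ell-1)},\qquad \mathbf z^{(\ell)}=\mathbf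 D^{(\ell)}\tilde{\mathbf z}^{(\ell)},$$ so that $\tilde{\mathbf z}^{(L)}=\mathbf J(\hat{\mathbf x})\mathbf z^{(0)}$ with the input-output Jacobian $$\mathbf J(\hat{\mathbf x})=\tfrac1{\sqrt{n_{L-1}}}\mathbf W^{(L-1)}\mathbf D^{(L-1)}\tfrac1{\sqrt{n_{L-2}}}\mathbf W^{(L-2)}\cdots\mathbf D^{(1)}\tfrac1{\sqrt{n_0}}\mathbf W^{(0)}.$$ Define random variables $\hat\alpha^{(\ell)},\hat z^{(\ell)}$, $\ell\ge1$, recursively by $\hat\alpha^{(\ell)}=\sigma(a)$, $\hat z^{(\ell)}=\sigma'(a)\,b$, where $(a,b)\sim\mathcal N(\mathbf 0,\Sigma^{(\ell)})$ is a centered bivariate Gaussian vector (possibly degenerate) with $$\Sigma^{(1)}=\frac1{n_0}\begin{bmatrix}\|\hat{\mathbf x}\|_2^2&\hat{\mathbf x}^T\mathbf z^{(0)}\\ \hat{\mathbf x}^T\mathbf z^{(0)}&\|\mathbf z^{(0)}\|_2^2\end{bmatrix},\qquad \Sigma^{(\ell+1)}=\begin{bmatrix}\mathbb E[(\hat\alpha^{(\ell)})^2]&\mathbb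 E[\hat\alpha^{(\ell)}\hat z^{(\ell)}]\\ \mathbb E[\hat\alpha^{(\ell)}\hat z^{(\ell)}]&\mathbb E[(\hat z^{(\ell)})^2]\end{bmatrix}.$$ Then this recursion is well defined: each $\Sigma^{(\ell)}$ is positive semidefinite, and $\hat\alpha^{(\ell)}$ and $\hat z^{(\ell)}$ are square integrable. Moreover, in the sequential limit $n_1\to\infty$, then $n_2\to\infty$, ..., then $n_{L-1}\to\infty$ (with $n_0,n_L$ fixed), in the sense of convergence in distribution: 1. for every $1\le\ell\le L-1$ and every fixed index $i$, the coordinate $\mathbf z^{(\ell)}_i$ converges to $\hat z^{(\ell)}$; 2. every coordinate $\tilde{\mathbf z}^{(L)}_i=(\mathbf J(\hat{\mathbf x})\mathbf z^{(0)})_i$, $1\le i\le n_L$, converges to $\mathcal N\big(0,\mathbb E[(\hat z^{(L-1)})^2]\big)$. -/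

import Mathlib

open MeasureTheory ProbabilityTheory Filter Topology
open scoped NNReal Matrix

namespace WideNet

section Network

/-- The layer widths `n_0, n_1, …, n_k, n_{k+1}` of a network with input width `n₀`,
hidden widths `m 0, …, m (k-1)` (so `n_{ℓ+1} = m ℓ`) and output width `nL`. -/
def widths (n₀ : ℕ) {k : ℕ} (m : Fin k → ℕ) (nL : ℕ) : ℕ → ℕ
  | 0 => n₀
  | ℓ + 1 => if h : ℓ < k then m ⟨ℓ, h⟩ else nL

theorem widths_last (n₀ : ℕ) {k : ℕ} (m : Fin k → ℕ) (nL : ℕ) :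
    widths n₀ m nL (k + 1) = nL := by
  simp [widths]

/-- Weight matrices `W^(ℓ) ∈ ℝ^{n_{ℓ+1} × n_ℓ}`. A network of depth `L` uses those with `ℓ < L`. -/
abbrev Weights (n : ℕ → ℕ) : Type :=
  (ℓ : ℕ) → Matrix (Fin (n (ℓ + 1))) (Fin (n ℓ)) ℝ

variable {n : ℕ → ℕ}

/-- `preact σ W x ℓ` is the vector of preactivations of layer `ℓ + 1`: the product of
`n_ℓ^{-1/2} W^(ℓ)` with the activations of layer `ℓ`, where the activations of layer `0` are
the input `x` and those of a later layer are `σ` applied entrywise to its preactivations. -/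
noncomputable def preact (σ : ℝ → ℝ) (W : Weights n) (x : Fin (n 0) → ℝ) :
    (ℓ : ℕ) → Fin (n (ℓ + 1)) → ℝ
  | 0 => (1 / √(n 0 : ℝ)) • (W 0 *ᵥ x)
  | ℓ + 1 => (1 / √(n (ℓ + 1) : ℝ)) • (W (ℓ + 1) *ᵥ fun j => σ (preact σ W x ℓ j))

/-- The diagonal matrix `D^(ℓ+1)` of the derivatives of `σ` at the preactivations of
layer `ℓ + 1`. -/
noncomputable def gate (σ : ℝ → ℝ) (W : Weights n) (x : Fin (n 0) → ℝ) (ℓ : ℕ) :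
    Matrix (Fin (n (ℓ + 1))) (Fin (n (ℓ + 1))) ℝ :=
  Matrix.diagonal fun j => deriv σ (preact σ W x ℓ j)

/-- `jacobian σ W x ℓ` is the input-output Jacobian of the network of depth `ℓ + 1`, that is
`n_ℓ^{-1/2} W^(ℓ) D^(ℓ) n_{ℓ-1}^{-1/2} W^(ℓ-1) D^(ℓ-1) ⋯ D^(1) n_0^{-1/2} W^(0)`. -/
noncomputable def jacobian (σ : ℝ → ℝ) (W : Weights n) (x : Fin (n 0) → ℝ) :
    (ℓ : ℕ) → Matrix (Fin (n (ℓ + 1))) (Fin (n 0)) ℝ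
  | 0 => (1 / √(n 0 : ℝ)) • W 0
  | ℓ + 1 => ((1 / √(n (ℓ + 1) : ℝ)) • W (ℓ + 1)) * (gate σ W x ℓ * jacobian σ W x ℓ)

/-- `zTilde σ W x z ℓ` is the vector `z̃^(ℓ+1)`: `z̃^(ℓ+1) = n_ℓ^{-1/2} W^(ℓ) z^(ℓ)`, where
`z^(0) = z` and `z^(ℓ) = D^(ℓ) z̃^(ℓ)`. -/
noncomputable def zTilde (σ : ℝ → ℝ) (W : Weights n) (x z : Fin (n 0) → ℝ) :
    (ℓ : ℕ) → Fin (n (ℓ + 1)) → ℝ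
  | 0 => (1 / √(n 0 : ℝ)) • (W 0 *ᵥ z)
  | ℓ + 1 => (1 / √(n (ℓ + 1) : ℝ)) • (W (ℓ + 1) *ᵥ (gate σ W x ℓ *ᵥ zTilde σ W x z ℓ))

/-- `zVec σ W x z ℓ` is the vector `z^(ℓ+1) = D^(ℓ+1) z̃^(ℓ+1)`. -/
noncomputable def zVec (σ : ℝ → ℝ) (W : Weights n) (x z : Fin (n 0) → ℝ) (ℓ : ℕ) :
    Fin (n (ℓ + 1)) → ℝ :=
  gate σ W x ℓ *ᵥ zTilde σ W x z ℓ

/-- The recursively defined `z̃` is the Jacobian-vector product. -/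
theorem jacobian_mulVec (σ : ℝ → ℝ) (W : Weights n) (x z : Fin (n 0) → ℝ) (ℓ : ℕ) :
    jacobian σ W x ℓ *ᵥ z = zTilde σ W x z ℓ := by
  induction ℓ with
  | zero => simp [jacobian, zTilde, Matrix.smul_mulVec]
  | succ ℓ ih =>
    simp only [jacobian, zTilde, ← Matrix.mulVec_mulVec, ih, Matrix.smul_mulVec]

/-- The `i`-th coordinate of a vector of length `N`, for a fixed `i` and varying `N`; the value
`0` for `N ≤ i` is irrelevant when `N → ∞`. -/
def coord {N : ℕ} (v : Fin N → ℝ) (i : ℕ) : ℝ :=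
  if h : i < N then v ⟨i, h⟩ else 0

/-- Random initialization of a network of depth `L`: the entries of the weight matrices
`W^(0), …, W^(L-1)` are independent standard Gaussian random variables. -/
structure IsGaussianInit {Ω : Type*} [MeasurableSpace Ω] (L : ℕ) (W : Ω → Weights n)
    (P : Measure Ω) : Prop where
  hasLaw : ∀ ℓ < L, ∀ i j, HasLaw (fun ω => W ω ℓ i j) (gaussianReal 0 1) P
  indep : iIndepFun
    (fun (e : (ℓ : Fin L) × (Fin (n (ℓ + 1)) × Fin (n ℓ))) (ω : Ω) => W ω e.1 e.2.1 e.2.2) P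

end Network

section SequentialLimit

/-- Iterated limit of `F` as its first variable tends to infinity, then its second one, and so
on: `lim_{n_k → ∞} ⋯ lim_{n_2 → ∞} lim_{n_1 → ∞} F (n_1, …, n_k) = y`. -/
def SeqTendsto {Y : Type*} [TopologicalSpace Y] : (k : ℕ) → ((Fin k → ℕ) → Y) → Y → Prop
  | 0, F, y => ∀ m, F m = y
  | k + 1, F, y => ∃ G : (Fin k → ℕ) → Y,
      (∀ m : Fin k → ℕ, Tendsto (fun N : ℕ => F (Fin.cons N m)) atTop (𝓝 (G m))) ∧
        SeqTendsto k G y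

/-- The real random variables `X m`, indexed by `m = (n_1, …, n_k)`, converge in distribution to
the random variable `Z` in the sequential limit `n_1 → ∞`, then `n_2 → ∞`, …, then `n_k → ∞`:
their laws do so for the topology of weak convergence. -/
structure SeqTendstoInDistribution {Ω Ω' : Type*} [MeasurableSpace Ω] [MeasurableSpace Ω'] {k : ℕ}
    (X : (Fin k → ℕ) → Ω → ℝ) (P : Measure Ω) [IsProbabilityMeasure P]
    (Z : Ω' → ℝ) (P' : Measure Ω') [IsProbabilityMeasure P'] : Prop where
  aemeasurable : ∀ m, AEMeasurable (X m) P
  aemeasurable_limit : AEMeasurable Z P'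
  tendsto : SeqTendsto (Y := ProbabilityMeasure ℝ) k
    (fun m => ⟨P.map (X m), Measure.isProbabilityMeasure_map (aemeasurable m)⟩)
    ⟨P'.map Z, Measure.isProbabilityMeasure_map aemeasurable_limit⟩

end SequentialLimit

section LimitRecursion

/-- The limiting activation `σ(a)` as a function of the pair `p = (a, b)`. -/
def actHat (σ : ℝ → ℝ) (p : EuclideanSpace ℝ (Fin 2)) : ℝ := σ (p 0)

/-- The limiting Jacobian-vector coordinate `σ'(a) b` as a function of the pair `p = (a, b)`. -/
noncomputable def zHat (σ : ℝ → ℝ) (p : EuclideanSpace ℝ (Fin 2)) : ℝ := deriv σ (p 0) * p 1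

/-- `pairCov σ x z ℓ` is the covariance matrix of the Gaussian pair `(a, b)` of layer `ℓ + 1`. -/
noncomputable def pairCov (σ : ℝ → ℝ) {n₀ : ℕ} (x z : EuclideanSpace ℝ (Fin n₀)) :
    ℕ → Matrix (Fin 2) (Fin 2) ℝ
  | 0 => !![‖x‖ ^ 2 / n₀, inner ℝ x z / n₀; inner ℝ x z / n₀, ‖z‖ ^ 2 / n₀]
  | ℓ + 1 =>
    let γ := multivariateGaussian (0 : EuclideanSpace ℝ (Fin 2)) (pairCov σ x z ℓ)
    !![∫ p, actHat σ p ^ 2 ∂γ, ∫ p, actHat σ p * zHat σ p ∂γ;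
       ∫ p, actHat σ p * zHat σ p ∂γ, ∫ p, zHat σ p ^ 2 ∂γ]

/-- The law of the Gaussian pair `(a, b)` of layer `ℓ + 1`. Under it, `actHat σ` and `zHat σ` are
the random variables `α̂^(ℓ+1) = σ(a)` and `ẑ^(ℓ+1) = σ'(a) b`. -/
noncomputable def pairLaw (σ : ℝ → ℝ) {n₀ : ℕ} (x z : EuclideanSpace ℝ (Fin n₀)) (ℓ : ℕ) :
    Measure (EuclideanSpace ℝ (Fin 2)) :=
  multivariateGaussian 0 (pairCov σ x z ℓ)

instance (σ : ℝ → ℝ) {n₀ : ℕ} (x z : EuclideanSpace ℝ (Fin n₀)) (ℓ : ℕ) :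
    IsProbabilityMeasure (pairLaw σ x z ℓ) := by
  unfold pairLaw; infer_instance

end LimitRecursion

end WideNet

/-! Given one layer, the pairs (preactivation, `z̃`) of the next layer are i.i.d. centered Gaussian;
their covariance is the empirical second-moment matrix of `(actHat σ, zHat σ)` over the given layer
(`nextMean_eq`). If that layer consists of `N` i.i.d. pairs, the strong law sends this matrix to
`limitCov` as `N → ∞`. The next layer then becomes i.i.d. Gaussian with the next limiting
covariance, and the widths can be sent to infinity one at a time (`seqTendsto_readoutLaw`).

The obstacle is that `σ'` is merely measurable, so weak convergence of the pairs does not pass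
through the gates. The test functions are therefore those of `ContinuousInSnd`: measurable in the
preactivations, continuous in `z̃`. This class is stable under averaging over a layer
(`ContinuousInSnd.nextMean`), and Gaussian integrals of its members converge with the covariance
(`ContinuousInSnd.tendsto_integral_pi`). Indeed, either the limiting preactivation variance is
positive and the densities converge, or it is zero and then the empirical variances are almost
surely zero too. -/

namespace WideNet

/-! ### Gaussian pairs: linear images of Gaussian weights and Cholesky form. -/

section GaussianPair

/-- The Gram matrix of two vectors. -/
def gramPair {ι : Type*} [Fintype ι] (u v : ι → ℝ) : Matrix (Fin 2) (Fin 2) ℝ :=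
  !![∑ j, u j ^ 2, ∑ j, u j * v j; ∑ j, u j * v j, ∑ j, v j ^ 2]

theorem dotProduct_gramPair {ι : Type*} [Fintype ι] (u v : ι → ℝ) (t : Fin 2 → ℝ) :
    t ⬝ᵥ gramPair u v *ᵥ t = ∑ j, (t 0 * u j + t 1 * v j) ^ 2 := by
  simp only [gramPair, dotProduct, Matrix.mulVec, Fin.sum_univ_two, Matrix.of_apply,
    Matrix.cons_val', Matrix.cons_val_zero, Matrix.cons_val_one, Matrix.cons_val_fin_one]
  have h : ∀ j, (t 0 * u j + t 1 * v j) ^ 2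
      = t 0 ^ 2 * u j ^ 2 + 2 * t 0 * t 1 * (u j * v j) + t 1 ^ 2 * v j ^ 2 := fun j => by ring
  simp only [h, Finset.sum_add_distrib, ← Finset.mul_sum]
  ring

theorem posSemidef_two_of_nonneg {S : Matrix (Fin 2) (Fin 2) ℝ} (h₁ : S 0 1 = S 1 0)
    (h₂ : ∀ t : Fin 2 → ℝ, 0 ≤ t ⬝ᵥ S *ᵥ t) : S.PosSemidef := by
  refine Matrix.PosSemidef.of_dotProduct_mulVec_nonneg ?_ fun t => by simpa using h₂ t
  ext i j
  fin_cases i <;> fin_cases j <;> simp [h₁]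

theorem gramPair_posSemidef {ι : Type*} [Fintype ι] (u v : ι → ℝ) : (gramPair u v).PosSemidef := by
  refine posSemidef_two_of_nonneg (by simp [gramPair]) fun t => ?_
  rw [dotProduct_gramPair]
  positivity

/-- The combination of the two coordinates with coefficients `t` pairs the weights with `t 0 • u + t
1 • v`, so the characteristic function is that of a standard Gaussian vector at this point. -/
theorem map_pi_gaussianReal_eq_multivariateGaussian {ι : Type*} [Fintype ι] (u v : ι → ℝ) :
    (Measure.pi fun _ : ι => gaussianReal 0 1).map
      (fun w => (!₂[∑ j, w j * u j, ∑ j, w j * v j] : EuclideanSpace ℝ (Fin 2)))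
      = multivariateGaussian 0 (gramPair u v) := by
  classical
  have hm : Measurable fun w : ι → ℝ =>
      (!₂[∑ j, w j * u j, ∑ j, w j * v j] : EuclideanSpace ℝ (Fin 2)) := by fun_prop
  have : IsProbabilityMeasure ((Measure.pi fun _ : ι => gaussianReal 0 1).map
      (fun w => (!₂[∑ j, w j * u j, ∑ j, w j * v j] : EuclideanSpace ℝ (Fin 2)))) :=
    Measure.isProbabilityMeasure_map hm.aemeasurable
  refine Measure.ext_of_charFun ?_
  ext t
  rw [charFun_multivariateGaussian (gramPair_posSemidef u v), dotProduct_gramPair]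
  set s : EuclideanSpace ℝ ι := WithLp.toLp 2 fun j => t 0 * u j + t 1 * v j with hs
  have h := charFun_stdGaussian s
  rw [← map_pi_eq_stdGaussian, charFun_apply, integral_map (by fun_prop) (by fun_prop)] at h
  rw [charFun_apply, integral_map (by fun_prop) (by fun_prop)]
  rw [← Complex.ofReal_pow, EuclideanSpace.real_norm_sq_eq] at h
  convert h using 1
  · refine integral_congr_ae (ae_of_all _ fun w => ?_)
    simp only [PiLp.inner_apply, Fin.sum_univ_two, hs]
    congr 3
    simp [Finset.mul_sum, ← Finset.sum_add_distrib]
    refine Finset.sum_congr rfl fun j _ => ?_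
    ring
  · simp [hs, neg_div]

/-- The Cholesky factorization of a Gaussian pair, as a function of an independent pair with
laws `N(0, S 0 0)` and `N(0, 1)`. -/
noncomputable def choleskyPair (S : Matrix (Fin 2) (Fin 2) ℝ) (p : ℝ × ℝ) :
    EuclideanSpace ℝ (Fin 2) :=
  !₂[p.1, S 0 1 / S 0 0 * p.1 + √(S 1 1 - S 0 1 ^ 2 / S 0 0) * p.2]

@[fun_prop]
theorem measurable_choleskyPair (S : Matrix (Fin 2) (Fin 2) ℝ) : Measurable (choleskyPair S) := by
  unfold choleskyPair; fun_prop

theorem posSemidef_two_entries {S : Matrix (Fin 2) (Fin 2) ℝ} (hS : S.PosSemidef) :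
    0 ≤ S 0 0 ∧ 0 ≤ S 1 1 ∧ S 1 0 = S 0 1 ∧ S 0 1 ^ 2 ≤ S 0 0 * S 1 1 := by
  have h := hS.det_nonneg
  have h' := hS.isHermitian.apply 0 1
  simp only [star_trivial] at h'
  rw [Matrix.det_fin_two] at h
  refine ⟨hS.diag_nonneg, hS.diag_nonneg, h', ?_⟩
  rw [h'] at h
  nlinarith

/-- The first coordinate is the first Gaussian itself, not a multiple of a standard one. When `S`
varies, the map then moves only the second coordinate; the first changes only in law. -/
theorem multivariateGaussian_eq_map_choleskyPair {S : Matrix (Fin 2) (Fin 2) ℝ}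
    (hS : S.PosSemidef) :
    multivariateGaussian 0 S
      = ((gaussianReal 0 (S 0 0).toNNReal).prod (gaussianReal 0 1)).map (choleskyPair S) := by
  obtain ⟨h0, h1, h10, hdet⟩ := posSemidef_two_entries hS
  set c := S 0 1 / S 0 0 with hc
  set d := S 1 1 - S 0 1 ^ 2 / S 0 0 with hd
  -- If `S 0 0 = 0`, division by zero gives `c = 0`, and semidefiniteness forces `S 0 1 = 0`, so the
  -- degenerate case is covered.
  have hq : c * S 0 0 = S 0 1 := by
    rcases eq_or_ne (S 0 0) 0 with h | h
    · have : S 0 1 ^ 2 ≤ 0 := by simpa [h] using hdet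
      have : S 0 1 = 0 := by nlinarith
      simp [h, this]
    · rw [hc]; field_simp
  have hd0 : 0 ≤ d := by
    rcases h0.eq_or_lt with h | h
    · simpa [hd, ← h] using h1
    · rw [hd, sub_nonneg, div_le_iff₀ h]; linarith
  -- The two vectors are the rows of the lower triangular Cholesky factor of `S`.
  have hG : gramPair ![√(S 0 0), 0] ![c * √(S 0 0), √d] = S := by
    have e : S 0 1 ^ 2 / S 0 0 = c * S 0 1 := by rw [hc]; ring
    ext i j
    fin_cases i <;> fin_cases j <;>
      simp [gramPair, Fin.sum_univ_two, Real.sq_sqrt h0, mul_pow, Real.sq_sqrt hd0, h10]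
    · rw [mul_left_comm, ← sq, Real.sq_sqrt h0, hq]
    · rw [mul_left_comm, ← sq, Real.sq_sqrt h0, hq]
    · rw [hd, e, ← hq]; ring
  rw [← hG, ← map_pi_gaussianReal_eq_multivariateGaussian, hG]
  have hs : gaussianReal 0 (S 0 0).toNNReal = (gaussianReal 0 1).map (√(S 0 0) * ·) := by
    rw [gaussianReal_map_const_mul]
    congr 1
    · simp
    · ext; simp [Real.sq_sqrt h0, h0]
  have hp : (gaussianReal 0 (S 0 0).toNNReal).prod (gaussianReal 0 1)
      = ((gaussianReal 0 1).prod (gaussianReal 0 1)).map (Prod.map (√(S 0 0) * ·) id) := by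
    rw [← Measure.map_prod_map _ _ (by fun_prop) measurable_id, ← hs, Measure.map_id]
  have hfin := (measurePreserving_finTwoArrow (gaussianReal 0 1)).map_eq
  have hm := measurable_choleskyPair S
  have hm' : Measurable (Prod.map (√(S 0 0) * ·) (id : ℝ → ℝ)) := by fun_prop
  rw [hp, ← hfin, Measure.map_map hm hm', Measure.map_map (hm.comp hm') (by fun_prop)]
  congr 1
  ext w i
  fin_cases i <;> simp [choleskyPair, Fin.sum_univ_two, ← hc, ← hd] <;> ring

end GaussianPair

/-! ### Convergence of measures tested on boundedly, pointwise converging integrands. -/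

section BoundedPointwiseConvergence

variable {X Y : Type*} [MeasurableSpace X] [MeasurableSpace Y]

/-- `∫ h N ∂μ N → ∫ h' ∂ν` for all uniformly bounded sequences of measurable functions `h N` that
converge pointwise to `h'`. -/
def TendstoBddPointwise (μ : ℕ → Measure X) (ν : Measure X) : Prop :=
  ∀ (h : ℕ → X → ℝ) (h' : X → ℝ) (C : ℝ), (∀ N, Measurable (h N)) → (∀ N x, |h N x| ≤ C) →
    (∀ x, Tendsto (fun N => h N x) atTop (𝓝 (h' x))) →
    Tendsto (fun N => ∫ x, h N x ∂μ N) atTop (𝓝 (∫ x, h' x ∂ν))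

theorem tendstoBddPointwise_const (ν : Measure X) [IsFiniteMeasure ν] :
    TendstoBddPointwise (fun _ => ν) ν := fun _ _ C hm hC hlim =>
  tendsto_integral_of_dominated_convergence (fun _ => C) (fun N => (hm N).aestronglyMeasurable)
    (integrable_const C) (fun N => ae_of_all _ (hC N)) (ae_of_all _ hlim)

theorem TendstoBddPointwise.map {μ : ℕ → Measure X} {ν : Measure X}
    (hμ : TendstoBddPointwise μ ν) {f : X → Y} (hf : Measurable f) :
    TendstoBddPointwise (fun N => (μ N).map f) (ν.map f) := by
  intro h h' C hm hC hlim
  have hm' : Measurable h' := measurable_of_tendsto_metrizable hm (tendsto_pi_nhds.2 hlim)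
  simp_rw [fun N => integral_map (μ := μ N) hf.aemeasurable (hm N).aestronglyMeasurable]
  rw [integral_map hf.aemeasurable hm'.aestronglyMeasurable]
  exact hμ _ _ C (fun N => (hm N).comp hf) (fun N x => hC N _) fun x => hlim _

theorem integrable_of_abs_le {μ : Measure X} [IsFiniteMeasure μ] {h : X → ℝ} {C : ℝ}
    (hm : Measurable h) (hC : ∀ x, |h x| ≤ C) : Integrable h μ :=
  Integrable.of_bound hm.aestronglyMeasurable C (ae_of_all _ hC)

theorem abs_integral_le_of_abs_le {μ : Measure X} [IsProbabilityMeasure μ] {h : X → ℝ} {C : ℝ}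
    (hC : ∀ x, |h x| ≤ C) : |∫ x, h x ∂μ| ≤ C := by
  simpa using norm_integral_le_of_norm_le_const (μ := μ) (f := h) (C := C) (ae_of_all _ hC)

/-- By Fubini, the inner integrals are again a bounded sequence converging pointwise; this is why
the integrands in `TendstoBddPointwise` may vary with `N`. -/
theorem TendstoBddPointwise.prod {μ : ℕ → Measure X} {ν : Measure X} {μ' : ℕ → Measure Y}
    {ν' : Measure Y} [∀ N, IsProbabilityMeasure (μ N)] [IsProbabilityMeasure ν]
    [∀ N, IsProbabilityMeasure (μ' N)] [IsProbabilityMeasure ν']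
    (hμ : TendstoBddPointwise μ ν) (hμ' : TendstoBddPointwise μ' ν') :
    TendstoBddPointwise (fun N => (μ N).prod (μ' N)) (ν.prod ν') := by
  intro h h' C hm hC hlim
  have hm' : Measurable h' := measurable_of_tendsto_metrizable hm (tendsto_pi_nhds.2 hlim)
  have hC' : ∀ x, |h' x| ≤ C := fun x => le_of_tendsto (hlim x).abs (Eventually.of_forall (hC · x))
  simp_rw [fun N => integral_prod (μ := μ N) (ν := μ' N) (h N) (integrable_of_abs_le (hm N) (hC N))]
  rw [integral_prod _ (integrable_of_abs_le hm' hC')]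
  refine hμ _ _ C (fun N => ?_) (fun N x => abs_integral_le_of_abs_le fun y => hC N _) fun x => ?_
  · exact ((hm N).stronglyMeasurable.integral_prod_right').measurable
  · exact hμ' _ _ C (fun N => (hm N).comp measurable_prodMk_left) (fun N y => hC N _) fun y => hlim _

theorem TendstoBddPointwise.pi {μ : ℕ → Measure X} {ν : Measure X}
    [∀ N, IsProbabilityMeasure (μ N)] [IsProbabilityMeasure ν] (hμ : TendstoBddPointwise μ ν)
    (n : ℕ) :
    TendstoBddPointwise (fun N => Measure.pi fun _ : Fin n => μ N)
      (Measure.pi fun _ : Fin n => ν) := by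
  induction n with
  | zero =>
    simp only [Measure.pi_of_empty _ default]
    exact tendstoBddPointwise_const _
  | succ n ih =>
    have h := (hμ.prod ih).map (MeasurableEquiv.piFinSuccAbove (fun _ => X) 0).symm.measurable
    have e : ∀ ρ : Measure X, ∀ [IsProbabilityMeasure ρ],
        (ρ.prod (Measure.pi fun _ : Fin n => ρ)).map
          (MeasurableEquiv.piFinSuccAbove (fun _ => X) 0).symm = Measure.pi fun _ : Fin (n + 1) => ρ :=
      fun ρ _ => ((measurePreserving_piFinSuccAbove (fun _ => ρ) 0).symm _).map_eq
    simpa only [e] using h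

/-- The densities converge under a common integrable bound. Positivity of `t` matters: Gaussians of
shrinking positive variance do not converge to a point mass when tested on discontinuous functions.
-/
theorem tendstoBddPointwise_gaussianReal {s : ℕ → ℝ} {t : ℝ} (hs : Tendsto s atTop (𝓝 t))
    (ht : 0 < t) :
    TendstoBddPointwise (fun N => gaussianReal 0 (s N).toNNReal) (gaussianReal 0 t.toNNReal) := by
  intro h h' C hm hC hlim
  -- The lower bound controls the normalizing factor of the density, the upper bound its
  -- exponential.
  have hev : ∀ᶠ N in atTop, s N ∈ Set.Ioo (t / 2) (2 * t) :=
    hs (Ioo_mem_nhds (by linarith) (by linarith))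
  rw [integral_gaussianReal_eq_integral_smul (by simpa using ht)]
  have hcongr : (fun N => ∫ x, gaussianPDFReal 0 (s N).toNNReal x • h N x)
      =ᶠ[atTop] fun N => ∫ x, h N x ∂gaussianReal 0 (s N).toNNReal := by
    filter_upwards [hev] with N hN
    rw [integral_gaussianReal_eq_integral_smul (by simpa using (half_pos ht).trans hN.1)]
  refine Tendsto.congr' hcongr ?_
  have hC0 : 0 ≤ C := (abs_nonneg _).trans (hC 0 0)
  refine tendsto_integral_filter_of_dominated_convergence
    (fun x => (√(2 * Real.pi * (t / 2)))⁻¹ * Real.exp (-(1 / (4 * t)) * x ^ 2) * C) ?_ ?_ ?_ ?_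
  · exact Eventually.of_forall fun N =>
      ((measurable_gaussianPDFReal _ _).smul (hm N)).aestronglyMeasurable
  · filter_upwards [hev] with N hN
    refine ae_of_all _ fun x => ?_
    have hN0 : 0 < s N := (half_pos ht).trans hN.1
    rw [norm_smul, Real.norm_eq_abs, Real.norm_eq_abs, abs_of_nonneg (gaussianPDFReal_nonneg _ _ _)]
    refine mul_le_mul ?_ (hC N x) (abs_nonneg _) (by positivity)
    rw [gaussianPDFReal_def]
    simp only [Real.coe_toNNReal _ hN0.le, sub_zero]
    refine mul_le_mul ?_ ?_ (by positivity) (by positivity)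
    · have := hN.1.le
      gcongr
    · rw [Real.exp_le_exp, neg_mul, neg_div, neg_le_neg_iff, one_div_mul_eq_div]
      have := hN.2.le
      refine div_le_div_of_nonneg_left (sq_nonneg x) (by positivity) (by linarith)
  · exact ((integrable_exp_neg_mul_sq (by positivity)).const_mul _).mul_const _
  · refine ae_of_all _ fun x => Tendsto.smul ?_ (hlim x)
    simp only [gaussianPDFReal_def]
    have hs' : Tendsto (fun N => ((s N).toNNReal : ℝ)) atTop (𝓝 (t.toNNReal : ℝ)) :=
      NNReal.tendsto_coe.2 (tendsto_real_toNNReal hs)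
    have ht' : (t.toNNReal : ℝ) ≠ 0 := by simp [ht.le, ht.ne']
    refine Tendsto.mul (Tendsto.inv₀ ?_ ?_) ?_
    · exact (Real.continuous_sqrt.tendsto _).comp (hs'.const_mul _)
    · rw [Real.sqrt_ne_zero']
      have := ht'.symm.lt_of_le (NNReal.coe_nonneg _)
      positivity
    · exact (Real.continuous_exp.tendsto _).comp
        (Tendsto.div tendsto_const_nhds (hs'.const_mul _) (mul_ne_zero two_ne_zero ht'))

end BoundedPointwiseConvergence

/-! ### Continuity of Gaussian integrals in the covariance. -/

section PartialContinuity

/-- `S N → S'` with constant first components. -/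
def TendstoSnd {n : ℕ} (S : ℕ → Fin n → EuclideanSpace ℝ (Fin 2))
    (S' : Fin n → EuclideanSpace ℝ (Fin 2)) : Prop :=
  ∀ j, (∀ N, S N j 0 = S' j 0) ∧ Tendsto (fun N => S N j 1) atTop (𝓝 (S' j 1))

/-- Bounded measurable functions of a family of pairs that are continuous in the second
components. -/
structure ContinuousInSnd {n : ℕ} (h : (Fin n → EuclideanSpace ℝ (Fin 2)) → ℝ) : Prop where
  measurable : Measurable h
  bounded : ∃ C, ∀ S, |h S| ≤ C
  tendsto : ∀ S S', TendstoSnd S S' → Tendsto (fun N => h (S N)) atTop (𝓝 (h S'))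

/-- In Cholesky form the first components, where `h` is only measurable, do not move with `N`. Their
laws converge in the strong sense above, and `h0` excludes positive variances shrinking to zero. -/
theorem ContinuousInSnd.tendsto_integral_pi {n : ℕ}
    {h : (Fin n → EuclideanSpace ℝ (Fin 2)) → ℝ} (hh : ContinuousInSnd h)
    {V : ℕ → Matrix (Fin 2) (Fin 2) ℝ} {V' : Matrix (Fin 2) (Fin 2) ℝ}
    (hV : ∀ N, (V N).PosSemidef) (hV' : V'.PosSemidef) (hlim : Tendsto V atTop (𝓝 V'))
    (h0 : V' 0 0 = 0 → ∀ N, V N 0 0 = 0) :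
    Tendsto (fun N => ∫ S, h S ∂Measure.pi fun _ : Fin n => multivariateGaussian 0 (V N)) atTop
      (𝓝 (∫ S, h S ∂Measure.pi fun _ : Fin n => multivariateGaussian 0 V')) := by
  have hrep : ∀ U : Matrix (Fin 2) (Fin 2) ℝ, U.PosSemidef →
      ∫ S, h S ∂(Measure.pi fun _ : Fin n => multivariateGaussian 0 U)
      = ∫ p, h (fun i => choleskyPair U (p i)) ∂(Measure.pi fun _ : Fin n =>
        (gaussianReal 0 (U 0 0).toNNReal).prod (gaussianReal 0 1)) := by
    intro U hU
    have hm := measurable_choleskyPair U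
    have := Measure.isProbabilityMeasure_map (μ := (gaussianReal 0 (U 0 0).toNNReal).prod
      (gaussianReal 0 1)) hm.aemeasurable
    rw [multivariateGaussian_eq_map_choleskyPair hU,
      ← Measure.pi_map_pi (fun _ => hm.aemeasurable),
      integral_map (Measurable.aemeasurable (by fun_prop)) hh.measurable.aestronglyMeasurable]
  simp_rw [fun N => hrep (V N) (hV N)]
  rw [hrep V' hV']
  have hent : ∀ i j, Tendsto (fun N => V N i j) atTop (𝓝 (V' i j)) := fun i j =>
    tendsto_pi_nhds.1 (tendsto_pi_nhds.1 hlim i) j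
  have hgauss : TendstoBddPointwise (fun N => gaussianReal 0 (V N 0 0).toNNReal)
      (gaussianReal 0 (V' 0 0).toNNReal) := by
    rcases (posSemidef_two_entries hV').1.eq_or_lt with h | h
    · simp only [h0 h.symm, h.symm]
      exact tendstoBddPointwise_const _
    · exact tendstoBddPointwise_gaussianReal (hent 0 0) h
  -- In the degenerate case all these quotients are divisions by zero, hence `0`.
  have hq : ∀ q : ℕ → ℝ, ∀ q' : ℝ, Tendsto q atTop (𝓝 q') →
      Tendsto (fun N => q N / V N 0 0) atTop (𝓝 (q' / V' 0 0)) := by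
    intro q q' hqq
    rcases eq_or_ne (V' 0 0) 0 with h | h
    · simp [h0 h, h]
    · exact hqq.div (hent 0 0) h
  obtain ⟨C, hC⟩ := hh.bounded
  refine (hgauss.prod (tendstoBddPointwise_const (gaussianReal 0 1))).pi n _ _ C (fun N => ?_)
    (fun N p => hC _) fun p => hh.tendsto _ _ fun j => ⟨fun N => rfl, ?_⟩
  · have := hh.measurable
    fun_prop
  · simp only [choleskyPair, PiLp.toLp_apply, Matrix.cons_val_one, Matrix.cons_val_fin_one]
    exact ((hq _ _ (hent 0 1)).mul_const _).add
      (((Real.continuous_sqrt.tendsto _).comp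
        ((hent 1 1).sub (hq _ _ ((hent 0 1).pow 2)))).mul_const _)

end PartialContinuity

/-! ### The transition from one layer to the next. -/

section Transition

variable (σ : ℝ → ℝ)

/-- The pairs (preactivation, `z̃`) of the next layer as a function of those of the current layer
and of the weights. -/
noncomputable def nextPairs {n n' : ℕ} (S : Fin n → EuclideanSpace ℝ (Fin 2))
    (A : Fin n' → Fin n → ℝ) : Fin n' → EuclideanSpace ℝ (Fin 2) :=
  fun i => !₂[∑ j, A i j * (1 / √(n : ℝ) * actHat σ (S j)),
    ∑ j, A i j * (1 / √(n : ℝ) * zHat σ (S j))]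

/-- The empirical covariance matrix of a layer. -/
noncomputable def empiricalCov {n : ℕ} (S : Fin n → EuclideanSpace ℝ (Fin 2)) :
    Matrix (Fin 2) (Fin 2) ℝ :=
  gramPair (fun j => 1 / √(n : ℝ) * actHat σ (S j)) fun j => 1 / √(n : ℝ) * zHat σ (S j)

/-- The law of a matrix with independent standard Gaussian entries. -/
noncomputable def gaussianMatrix (n' n : ℕ) : Measure (Fin n' → Fin n → ℝ) :=
  Measure.pi fun _ => Measure.pi fun _ => gaussianReal 0 1

instance (n' n : ℕ) : IsProbabilityMeasure (gaussianMatrix n' n) := by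
  unfold gaussianMatrix; infer_instance

theorem map_gaussianMatrix_eq_pi {n n' : ℕ} (u v : Fin n → ℝ) :
    (gaussianMatrix n' n).map (fun A i => (!₂[∑ j, A i j * u j, ∑ j, A i j * v j] :
      EuclideanSpace ℝ (Fin 2))) = Measure.pi fun _ => multivariateGaussian 0 (gramPair u v) := by
  simp_rw [← map_pi_gaussianReal_eq_multivariateGaussian u v]
  have hm : Measurable fun w : Fin n → ℝ =>
      (!₂[∑ j, w j * u j, ∑ j, w j * v j] : EuclideanSpace ℝ (Fin 2)) := by fun_prop
  have := Measure.isProbabilityMeasure_map (μ := Measure.pi fun _ : Fin n => gaussianReal 0 1)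
    hm.aemeasurable
  rw [← Measure.pi_map_pi fun _ => hm.aemeasurable]
  rfl

variable {σ}

theorem measurable_actHat (hσ : Measurable σ) : Measurable (actHat σ) := by
  unfold actHat; fun_prop

theorem measurable_zHat (σ : ℝ → ℝ) : Measurable (zHat σ) := by
  have := measurable_deriv σ
  unfold zHat; fun_prop

theorem measurable_nextPairs (hσ : Measurable σ) {n n' : ℕ} :
    Measurable fun q : (Fin n → EuclideanSpace ℝ (Fin 2)) × (Fin n' → Fin n → ℝ) =>
      nextPairs σ q.1 q.2 := by
  have h₁ := measurable_actHat hσ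
  have h₂ := measurable_zHat σ
  unfold nextPairs
  fun_prop

variable (σ) in
/-- The law of the pairs of the next layer, for independent Gaussian weights. -/
noncomputable def nextLaw {n : ℕ} (n' : ℕ) (μ : Measure (Fin n → EuclideanSpace ℝ (Fin 2))) :
    Measure (Fin n' → EuclideanSpace ℝ (Fin 2)) :=
  (μ.prod (gaussianMatrix n' n)).map fun q => nextPairs σ q.1 q.2

theorem isProbabilityMeasure_nextLaw (hσ : Measurable σ) {n n' : ℕ}
    (μ : Measure (Fin n → EuclideanSpace ℝ (Fin 2))) [IsProbabilityMeasure μ] :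
    IsProbabilityMeasure (nextLaw σ n' μ) :=
  Measure.isProbabilityMeasure_map (measurable_nextPairs hσ).aemeasurable

variable (σ) in
/-- The conditional expectation of a function of the next layer, given the current layer. -/
noncomputable def nextMean {n n' : ℕ} (h : (Fin n' → EuclideanSpace ℝ (Fin 2)) → ℝ)
    (S : Fin n → EuclideanSpace ℝ (Fin 2)) : ℝ :=
  ∫ A, h (nextPairs σ S A) ∂gaussianMatrix n' n

/-- The rows of the weight matrix are independent, and `S` enters each row's Gaussian pair only
through its Gram matrix. -/
theorem nextMean_eq (hσ : Measurable σ) {n n' : ℕ} {h : (Fin n' → EuclideanSpace ℝ (Fin 2)) → ℝ}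
    (hh : Measurable h) (S : Fin n → EuclideanSpace ℝ (Fin 2)) :
    nextMean σ h S = ∫ T, h T ∂Measure.pi fun _ => multivariateGaussian 0 (empiricalCov σ S) := by
  rw [empiricalCov, ← map_gaussianMatrix_eq_pi, integral_map _ hh.aestronglyMeasurable]
  · rfl
  · exact ((measurable_nextPairs hσ).comp measurable_prodMk_left).aemeasurable

/-- Activations and gates depend only on first components, which `TendstoSnd` freezes. The next
preactivations are then frozen as well, and the next `z̃` is linear in the second components. -/
theorem ContinuousInSnd.nextMean (hσ : Measurable σ) {n n' : ℕ}
    {h : (Fin n' → EuclideanSpace ℝ (Fin 2)) → ℝ} (hh : ContinuousInSnd h) :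
    ContinuousInSnd (nextMean σ h : (Fin n → EuclideanSpace ℝ (Fin 2)) → ℝ) := by
  obtain ⟨C, hC⟩ := hh.bounded
  have hm := hh.measurable.comp (measurable_nextPairs hσ (n := n) (n' := n'))
  refine ⟨?_, ⟨C, fun S => abs_integral_le_of_abs_le fun A => hC _⟩, fun S S' hS => ?_⟩
  · exact (hm.stronglyMeasurable.integral_prod_right').measurable
  · refine tendstoBddPointwise_const (gaussianMatrix n' n) _ _ C
      (fun N => hm.comp measurable_prodMk_left) (fun N A => hC _) fun A =>
        hh.tendsto _ _ fun i => ⟨fun N => ?_, ?_⟩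
    · simp [nextPairs, actHat, (hS _).1]
    · simp only [nextPairs, PiLp.toLp_apply, Matrix.cons_val_one, Matrix.cons_val_fin_one, zHat,
        (hS _).1]
      exact tendsto_finsetSum _ fun j _ => (((hS j).2.const_mul _).const_mul _).const_mul _

theorem integral_nextLaw (hσ : Measurable σ) {n n' : ℕ}
    {h : (Fin n' → EuclideanSpace ℝ (Fin 2)) → ℝ} (hh : ContinuousInSnd h)
    (μ : Measure (Fin n → EuclideanSpace ℝ (Fin 2))) [IsProbabilityMeasure μ] :
    ∫ T, h T ∂nextLaw σ n' μ = ∫ S, nextMean σ h S ∂μ := by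
  obtain ⟨C, hC⟩ := hh.bounded
  have hm := measurable_nextPairs hσ (n := n) (n' := n')
  rw [nextLaw, integral_map hm.aemeasurable hh.measurable.aestronglyMeasurable]
  exact integral_prod _ (integrable_of_abs_le (hh.measurable.comp hm) fun _ => hC _)

variable (σ) in
/-- The law of the pairs of layer `ℓ` of a network with layer widths `w`, given that of
layer `0`. -/
noncomputable def layerLaw (w : ℕ → ℕ) (μ : Measure (Fin (w 0) → EuclideanSpace ℝ (Fin 2))) :
    (ℓ : ℕ) → Measure (Fin (w ℓ) → EuclideanSpace ℝ (Fin 2))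
  | 0 => μ
  | ℓ + 1 => nextLaw σ (w (ℓ + 1)) (layerLaw w μ ℓ)

theorem isProbabilityMeasure_layerLaw (hσ : Measurable σ) (w : ℕ → ℕ)
    (μ : Measure (Fin (w 0) → EuclideanSpace ℝ (Fin 2))) [IsProbabilityMeasure μ] :
    ∀ ℓ, IsProbabilityMeasure (layerLaw σ w μ ℓ)
  | 0 => by assumption
  | ℓ + 1 => by
    have := isProbabilityMeasure_layerLaw hσ w μ ℓ
    exact isProbabilityMeasure_nextLaw hσ _

/-- The definition adds layers at the output end, whereas the sequential limit removes them at the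
input end. -/
theorem layerLaw_succ (w : ℕ → ℕ) (μ : Measure (Fin (w 0) → EuclideanSpace ℝ (Fin 2))) (ℓ : ℕ) :
    layerLaw σ w μ (ℓ + 1) = layerLaw σ (fun j => w (j + 1)) (nextLaw σ (w 1) μ) ℓ := by
  induction ℓ with
  | zero => rfl
  | succ ℓ ih => rw [layerLaw, ih]; rfl

/-- The later layers are averaged out into one test function of the first. It does not depend on
`μ`, so it stays fixed while the law of the first layer converges. -/
theorem ContinuousInSnd.exists_integral_layerLaw (hσ : Measurable σ) (w : ℕ → ℕ) {ℓ : ℕ}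
    {h : (Fin (w ℓ) → EuclideanSpace ℝ (Fin 2)) → ℝ} (hh : ContinuousInSnd h) :
    ∃ h' : (Fin (w 0) → EuclideanSpace ℝ (Fin 2)) → ℝ, ContinuousInSnd h' ∧
      ∀ μ : Measure (Fin (w 0) → EuclideanSpace ℝ (Fin 2)), IsProbabilityMeasure μ →
        ∫ S, h S ∂layerLaw σ w μ ℓ = ∫ S, h' S ∂μ := by
  induction ℓ with
  | zero => exact ⟨h, hh, fun μ _ => rfl⟩
  | succ ℓ ih =>
    obtain ⟨h', hh', e⟩ := ih (hh.nextMean hσ)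
    refine ⟨h', hh', fun μ hμ => ?_⟩
    have := isProbabilityMeasure_layerLaw hσ w μ ℓ
    rw [layerLaw, integral_nextLaw hσ hh, e μ hμ]

end Transition

/-! ### The law of large numbers for the empirical covariance. -/

section LawOfLargeNumbers

variable (σ : ℝ → ℝ)

/-- The matrix of second moments of `(actHat σ, zHat σ)`. -/
noncomputable def limitCov (γ : Measure (EuclideanSpace ℝ (Fin 2))) : Matrix (Fin 2) (Fin 2) ℝ :=
  !![∫ p, actHat σ p ^ 2 ∂γ, ∫ p, actHat σ p * zHat σ p ∂γ;
     ∫ p, actHat σ p * zHat σ p ∂γ, ∫ p, zHat σ p ^ 2 ∂γ]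

variable {σ} {γ : Measure (EuclideanSpace ℝ (Fin 2))}

theorem limitCov_posSemidef (hA : MemLp (actHat σ) 2 γ) (hZ : MemLp (zHat σ) 2 γ) :
    (limitCov σ γ).PosSemidef := by
  refine posSemidef_two_of_nonneg (by simp [limitCov]) fun t => ?_
  have hi : t ⬝ᵥ limitCov σ γ *ᵥ t = ∫ p, (t 0 * actHat σ p + t 1 * zHat σ p) ^ 2 ∂γ := by
    have h : ∀ p, (t 0 * actHat σ p + t 1 * zHat σ p) ^ 2 = t 0 ^ 2 * actHat σ p ^ 2
        + 2 * t 0 * t 1 * (actHat σ p * zHat σ p) + t 1 ^ 2 * zHat σ p ^ 2 := fun p => by ring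
    have h₁ := hA.integrable_sq.const_mul (t 0 ^ 2)
    have h₂ := (hA.integrable_mul hZ).const_mul (2 * t 0 * t 1)
    have h₃ := hZ.integrable_sq.const_mul (t 1 ^ 2)
    simp only [Pi.mul_apply] at h₂
    simp only [h]
    rw [integral_add (by exact h₁.add h₂) h₃, integral_add h₁ h₂, integral_const_mul,
      integral_const_mul, integral_const_mul]
    simp only [limitCov, dotProduct, Matrix.mulVec, Fin.sum_univ_two, Matrix.of_apply,
      Matrix.cons_val', Matrix.cons_val_zero, Matrix.cons_val_one, Matrix.cons_val_fin_one]
    ring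
  rw [hi]
  exact integral_nonneg fun p => sq_nonneg _

/-- A single infinite sequence carries the layers of all widths `N` as initial segments, so that
almost sure convergence makes sense. -/
theorem strong_law_infinitePi [IsProbabilityMeasure γ] {f : EuclideanSpace ℝ (Fin 2) → ℝ}
    (hf : Measurable f) (hi : Integrable f γ) :
    ∀ᵐ ω ∂(Measure.infinitePi fun _ : ℕ => γ),
      Tendsto (fun N : ℕ => (∑ i ∈ Finset.range N, f (ω i)) / N) atTop (𝓝 (∫ p, f p ∂γ)) := by
  have he : ∀ i : ℕ, MeasurePreserving (fun ω : ℕ → EuclideanSpace ℝ (Fin 2) => ω i)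
      (Measure.infinitePi fun _ => γ) γ := fun i => measurePreserving_eval_infinitePi _ i
  have h := strong_law_ae_real (μ := Measure.infinitePi fun _ : ℕ => γ) (fun i ω => f (ω i))
    ((he 0).integrable_comp_of_integrable hi)
    (fun i j hij => (iIndepFun_infinitePi (P := fun _ : ℕ => γ) (X := fun _ => f)
      fun _ => hf).indepFun hij)
    (fun i => (IdentDistrib.mk (he i).aemeasurable (he 0).aemeasurable
      ((he i).map_eq.trans (he 0).map_eq.symm)).comp hf)
  rwa [← integral_map (he 0).aemeasurable hf.aestronglyMeasurable, (he 0).map_eq] at h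

theorem empiricalCov_eq (N : ℕ) (ω : ℕ → EuclideanSpace ℝ (Fin 2)) :
    empiricalCov σ (fun j : Fin N => ω j) =
      !![(∑ i ∈ Finset.range N, actHat σ (ω i) ^ 2) / N,
         (∑ i ∈ Finset.range N, actHat σ (ω i) * zHat σ (ω i)) / N;
         (∑ i ∈ Finset.range N, actHat σ (ω i) * zHat σ (ω i)) / N,
         (∑ i ∈ Finset.range N, zHat σ (ω i) ^ 2) / N] := by
  have h : (1 / √(N : ℝ)) ^ 2 = (N : ℝ)⁻¹ := by rw [div_pow, Real.sq_sqrt (by positivity)]; simp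
  have key : ∀ f g : EuclideanSpace ℝ (Fin 2) → ℝ,
      ∑ j : Fin N, (1 / √(N : ℝ) * f (ω j)) * (1 / √(N : ℝ) * g (ω j))
        = (∑ i ∈ Finset.range N, f (ω i) * g (ω i)) / N := by
    intro f g
    rw [Finset.sum_range, Finset.sum_div]
    refine Finset.sum_congr rfl fun j _ => ?_
    rw [mul_mul_mul_comm, ← sq, h, inv_mul_eq_div]
  simp only [empiricalCov, gramPair, sq, key]

theorem tendsto_empiricalCov [IsProbabilityMeasure γ] (hσ : Measurable σ)
    (hA : MemLp (actHat σ) 2 γ) (hZ : MemLp (zHat σ) 2 γ) :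
    ∀ᵐ ω ∂(Measure.infinitePi fun _ : ℕ => γ),
      Tendsto (fun N : ℕ => empiricalCov σ fun j : Fin N => ω j) atTop (𝓝 (limitCov σ γ)) := by
  have mA := measurable_actHat hσ
  have mZ := measurable_zHat σ
  filter_upwards [strong_law_infinitePi (mA.pow_const 2) hA.integrable_sq,
    strong_law_infinitePi (mA.mul mZ) (hA.integrable_mul hZ),
    strong_law_infinitePi (mZ.pow_const 2) hZ.integrable_sq] with ω h₁ h₂ h₃
  simp only [empiricalCov_eq]
  refine tendsto_pi_nhds.2 fun i => tendsto_pi_nhds.2 fun j => ?_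
  fin_cases i <;> fin_cases j <;> simp [limitCov] <;> assumption

/-- A zero second moment makes `actHat σ` vanish almost surely. This supplies the hypothesis `h0` of
`ContinuousInSnd.tendsto_integral_pi`. -/
theorem empiricalCov_zero_zero [IsProbabilityMeasure γ] (hA : MemLp (actHat σ) 2 γ) (h0 : limitCov σ γ 0 0 = 0) :
    ∀ᵐ ω ∂(Measure.infinitePi fun _ : ℕ => γ),
      ∀ N : ℕ, empiricalCov σ (fun j : Fin N => ω j) 0 0 = 0 := by
  have h : ∀ᵐ p ∂γ, actHat σ p = 0 := by
    have := (integral_eq_zero_iff_of_nonneg (fun p => sq_nonneg _) hA.integrable_sq).1 h0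
    filter_upwards [this] with p hp
    exact pow_eq_zero_iff two_ne_zero |>.1 hp
  have h' : ∀ᵐ ω ∂(Measure.infinitePi fun _ : ℕ => γ), ∀ i : ℕ, actHat σ (ω i) = 0 :=
    ae_all_iff.2 fun i => (measurePreserving_eval_infinitePi (fun _ : ℕ => γ)
      i).quasiMeasurePreserving.ae h
  filter_upwards [h'] with ω hω N
  simp [empiricalCov_eq, hω]

/-- The law of the pairs of the layer that follows a layer of `N` independent pairs of law `γ`
becomes that of independent Gaussian pairs, as `N → ∞`. -/
theorem ContinuousInSnd.tendsto_integral_nextLaw [IsProbabilityMeasure γ] (hσ : Measurable σ)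
    (hA : MemLp (actHat σ) 2 γ) (hZ : MemLp (zHat σ) 2 γ) {n : ℕ}
    {h : (Fin n → EuclideanSpace ℝ (Fin 2)) → ℝ} (hh : ContinuousInSnd h) :
    Tendsto (fun N : ℕ => ∫ S, h S ∂nextLaw σ n (Measure.pi fun _ : Fin N => γ)) atTop
      (𝓝 (∫ S, h S ∂Measure.pi fun _ => multivariateGaussian 0 (limitCov σ γ))) := by
  obtain ⟨C, hC⟩ := hh.bounded
  have hpi : ∀ N : ℕ, (Measure.infinitePi fun _ : ℕ => γ).map (fun ω (j : Fin N) => ω j)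
      = Measure.pi fun _ : Fin N => γ := by
    intro N
    have hi := (iIndepFun_infinitePi (P := fun _ : ℕ => γ) (X := fun _ p => p)
      fun _ => measurable_id).precomp (Fin.val_injective (n := N))
    rw [iIndepFun_iff_map_fun_eq_pi_map fun j => Measurable.aemeasurable (by fun_prop)] at hi
    simpa only [Measure.infinitePi_map_eval] using hi
  have hrep : ∀ N : ℕ, ∫ S, h S ∂nextLaw σ n (Measure.pi fun _ : Fin N => γ)
      = ∫ ω, WideNet.nextMean σ h (fun j : Fin N => ω j) ∂(Measure.infinitePi fun _ : ℕ => γ) := by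
    intro N
    rw [integral_nextLaw hσ hh, ← hpi N,
      integral_map (Measurable.aemeasurable (by fun_prop)) (hh.nextMean hσ).measurable.aestronglyMeasurable]
  have hconst : ∫ S, h S ∂(Measure.pi fun _ => multivariateGaussian 0 (limitCov σ γ))
      = ∫ _ω, (∫ S, h S ∂Measure.pi fun _ => multivariateGaussian 0 (limitCov σ γ))
        ∂(Measure.infinitePi fun _ : ℕ => γ) := by simp
  simp_rw [hrep]
  rw [hconst]
  refine tendsto_integral_of_dominated_convergence (fun _ => C) (fun N => ?_) (integrable_const C)
    (fun N => ae_of_all _ fun ω => abs_integral_le_of_abs_le fun A => hC _) ?_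
  · have := (hh.nextMean hσ (n := N)).measurable
    exact Measurable.aestronglyMeasurable (by fun_prop)
  · have h00 : ∀ᵐ ω ∂(Measure.infinitePi fun _ : ℕ => γ), limitCov σ γ 0 0 = 0 →
        ∀ N : ℕ, empiricalCov σ (fun j : Fin N => ω j) 0 0 = 0 := by
      by_cases h0 : limitCov σ γ 0 0 = 0
      · filter_upwards [empiricalCov_zero_zero hA h0] with ω hω _ using hω
      · exact ae_of_all _ fun _ h0' => absurd h0' h0
    filter_upwards [tendsto_empiricalCov hσ hA hZ, h00] with ω hlim h0
    simp_rw [nextMean_eq hσ hh.measurable]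
    exact hh.tendsto_integral_pi (fun N => gramPair_posSemidef _ _) (limitCov_posSemidef hA hZ)
      hlim h0

end LawOfLargeNumbers

/-! ### Well-definedness of the limit recursion. -/

section LimitRecursion

variable {σ : ℝ → ℝ} {K : ℝ≥0}

theorem memLp_actHat (hσ : LipschitzWith K σ) (γ : Measure (EuclideanSpace ℝ (Fin 2)))
    [IsGaussian γ] : MemLp (actHat σ) 2 γ := by
  have h := (IsGaussian.memLp_two_id (μ := γ)).norm.const_mul (K : ℝ)
  have h' := h.add (memLp_const |σ 0|)
  refine h'.of_le (measurable_actHat hσ.continuous.measurable).aestronglyMeasurable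
    (ae_of_all _ fun p => ?_)
  have h₁ := hσ.dist_le_mul (p 0) 0
  simp only [Real.dist_eq, sub_zero] at h₁
  have h₂ : |p 0| ≤ ‖p‖ := PiLp.norm_apply_le p 0
  have h₃ : |σ (p 0)| ≤ |σ (p 0) - σ 0| + |σ 0| := by
    simpa using abs_add_le (σ (p 0) - σ 0) (σ 0)
  have h₄ : (K : ℝ) * |p 0| ≤ K * ‖p‖ := by gcongr
  simp only [actHat, Pi.add_apply, id, Real.norm_eq_abs]
  exact (h₃.trans (by linarith)).trans (le_abs_self _)

theorem memLp_zHat (hσ : LipschitzWith K σ) (γ : Measure (EuclideanSpace ℝ (Fin 2)))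
    [IsGaussian γ] : MemLp (zHat σ) 2 γ := by
  refine (IsGaussian.memLp_two_id (μ := γ)).of_le_mul (c := K)
    (measurable_zHat σ).aestronglyMeasurable (ae_of_all _ fun p => ?_)
  rw [zHat, norm_mul]
  exact mul_le_mul (norm_deriv_le_of_lipschitz hσ) (PiLp.norm_apply_le p 1) (norm_nonneg _)
    (NNReal.coe_nonneg _)

instance (σ : ℝ → ℝ) {n₀ : ℕ} (x z : EuclideanSpace ℝ (Fin n₀)) (ℓ : ℕ) :
    IsGaussian (pairLaw σ x z ℓ) := by
  unfold pairLaw; infer_instance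

theorem pairCov_zero_eq_gramPair (σ : ℝ → ℝ) {n₀ : ℕ} (x z : EuclideanSpace ℝ (Fin n₀)) :
    pairCov σ x z 0
      = gramPair (fun j => 1 / √(n₀ : ℝ) * x j) fun j => 1 / √(n₀ : ℝ) * z j := by
  have h : (1 / √(n₀ : ℝ)) ^ 2 = (n₀ : ℝ)⁻¹ := by rw [div_pow, Real.sq_sqrt (by positivity)]; simp
  have key : ∀ u v : EuclideanSpace ℝ (Fin n₀),
      ∑ j, (1 / √(n₀ : ℝ) * u j) * (1 / √(n₀ : ℝ) * v j) = inner ℝ u v / n₀ := by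
    intro u v
    rw [PiLp.inner_apply, Finset.sum_div]
    refine Finset.sum_congr rfl fun j _ => ?_
    rw [mul_mul_mul_comm, ← sq, h, inv_mul_eq_div]
    simp [mul_comm]
  simp only [pairCov, gramPair, sq, key, real_inner_self_eq_norm_mul_norm]

/-- No induction hypothesis is needed: `multivariateGaussian` is Gaussian for every matrix, so the
second moments always exist. -/
theorem pairCov_posSemidef (hσ : LipschitzWith K σ) {n₀ : ℕ} (x z : EuclideanSpace ℝ (Fin n₀)) :
    ∀ ℓ, (pairCov σ x z ℓ).PosSemidef
  | 0 => by
    rw [pairCov_zero_eq_gramPair]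
    exact gramPair_posSemidef _ _
  | ℓ + 1 => limitCov_posSemidef (memLp_actHat hσ (pairLaw σ x z ℓ))
      (memLp_zHat hσ (pairLaw σ x z ℓ))

end LimitRecursion

/-! ### Readouts of a layer and the sequential limit. -/

section Readout

theorem coord_of_lt {N i : ℕ} (v : Fin N → ℝ) (h : i < N) : coord v i = v ⟨i, h⟩ := dif_pos h

/-- Measurable functions of a pair that are continuous in its second component. -/
structure IsReadout (r : EuclideanSpace ℝ (Fin 2) → ℝ) : Prop where
  measurable : Measurable r
  tendsto : ∀ (p : ℕ → EuclideanSpace ℝ (Fin 2)) (p' : EuclideanSpace ℝ (Fin 2)),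
    (∀ N, p N 0 = p' 0) → Tendsto (fun N => p N 1) atTop (𝓝 (p' 1)) →
    Tendsto (fun N => r (p N)) atTop (𝓝 (r p'))

theorem isReadout_zHat (σ : ℝ → ℝ) : IsReadout (zHat σ) where
  measurable := measurable_zHat σ
  tendsto p p' h₀ h₁ := by
    simp only [zHat, h₀]
    exact h₁.const_mul _

theorem isReadout_snd : IsReadout fun p => p 1 where
  measurable := by fun_prop
  tendsto _ _ _ h₁ := h₁

variable {r : EuclideanSpace ℝ (Fin 2) → ℝ}

theorem IsReadout.measurable_coord (hr : IsReadout r) (n i : ℕ) :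
    Measurable fun S : Fin n → EuclideanSpace ℝ (Fin 2) => coord (fun j => r (S j)) i := by
  have := hr.measurable
  unfold coord
  split <;> fun_prop

theorem IsReadout.continuousInSnd (hr : IsReadout r) (n i : ℕ)
    (f : BoundedContinuousFunction ℝ ℝ) :
    ContinuousInSnd fun S : Fin n → EuclideanSpace ℝ (Fin 2) => f (coord (fun j => r (S j)) i) where
  measurable := f.continuous.measurable.comp (hr.measurable_coord n i)
  bounded := ⟨‖f‖, fun S => f.norm_coe_le_norm _⟩
  tendsto S S' hS := by
    refine (f.continuous.tendsto _).comp ?_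
    unfold coord
    split
    · exact hr.tendsto _ _ (hS _).1 (hS _).2
    · exact tendsto_const_nhds

theorem map_coord_pi (hr : Measurable r) {n i : ℕ} (hi : i < n)
    (γ : Measure (EuclideanSpace ℝ (Fin 2))) [IsProbabilityMeasure γ] :
    (Measure.pi fun _ : Fin n => γ).map (fun S => coord (fun j => r (S j)) i) = γ.map r := by
  have h := (measurePreserving_eval (fun _ : Fin n => γ) ⟨i, hi⟩)
  rw [← h.map_eq, Measure.map_map hr h.measurable, h.map_eq]
  congr 1
  ext S
  simp [coord, hi]

/-- The law of a coordinate of the readout of layer `ℓ`, when layer `0` consists of independent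
pairs of law `γ`. -/
noncomputable def readoutLaw (σ : ℝ → ℝ) (r : EuclideanSpace ℝ (Fin 2) → ℝ) (w : ℕ → ℕ)
    (γ : Measure (EuclideanSpace ℝ (Fin 2))) (ℓ i : ℕ) : Measure ℝ :=
  (layerLaw σ w (Measure.pi fun _ => γ) ℓ).map fun S => coord (fun j => r (S j)) i

/-- The layer widths `N, w 0, w 1, …`. -/
def consWidth (N : ℕ) (w : ℕ → ℕ) : ℕ → ℕ
  | 0 => N
  | ℓ + 1 => w ℓ

theorem widths_cons (n₀ : ℕ) {k : ℕ} (N : ℕ) (m : Fin k → ℕ) (nL : ℕ) :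
    (fun ℓ => widths n₀ (Fin.cons N m) nL (ℓ + 1))
      = consWidth N fun ℓ => widths n₀ m nL (ℓ + 1) := by
  funext ℓ
  cases ℓ with
  | zero => simp [widths, consWidth]
  | succ ℓ =>
    by_cases h : ℓ < k
    · simp only [widths, consWidth]
      rw [dif_pos h, dif_pos (Nat.succ_lt_succ h)]
      rfl
    · simp [widths, consWidth, h]

/-- The limit of a single width: the readout is pulled back to the layer of width `w 0`, where the
law of large numbers over the preceding `N` pairs applies. -/
theorem tendsto_readoutLaw {σ : ℝ → ℝ} (hσ : Measurable σ) (hr : IsReadout r) (w : ℕ → ℕ)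
    {γ : Measure (EuclideanSpace ℝ (Fin 2))} [IsProbabilityMeasure γ]
    (hA : MemLp (actHat σ) 2 γ) (hZ : MemLp (zHat σ) 2 γ) (ℓ i : ℕ)
    {F : ℕ → ProbabilityMeasure ℝ} {G : ProbabilityMeasure ℝ}
    (hF : ∀ N, (F N : Measure ℝ) = readoutLaw σ r (consWidth N w) γ (ℓ + 1) i)
    (hG : (G : Measure ℝ) = readoutLaw σ r w (multivariateGaussian 0 (limitCov σ γ)) ℓ i) :
    Tendsto F atTop (𝓝 G) := by
  refine ProbabilityMeasure.tendsto_iff_forall_integral_tendsto.2 fun f => ?_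
  obtain ⟨h', hh', e⟩ := (hr.continuousInSnd (w ℓ) i f).exists_integral_layerLaw hσ w
  have hm : ∀ μ : Measure (Fin (w ℓ) → EuclideanSpace ℝ (Fin 2)),
      ∫ t, f t ∂μ.map (fun S => coord (fun j => r (S j)) i)
        = ∫ S, f (coord (fun j => r (S j)) i) ∂μ := fun μ =>
    integral_map (hr.measurable_coord _ i).aemeasurable f.continuous.aestronglyMeasurable
  have hN : ∀ N, ∫ t, f t ∂(F N : Measure ℝ)
      = ∫ S, h' S ∂nextLaw σ (w 0) (Measure.pi fun _ : Fin N => γ) := by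
    intro N
    rw [hF N, readoutLaw, layerLaw_succ]
    exact (hm _).trans (e _ (isProbabilityMeasure_nextLaw hσ _))
  simp_rw [hN]
  rw [hG, readoutLaw, hm, e _ inferInstance]
  exact hh'.tendsto_integral_nextLaw hσ hA hZ

theorem seqTendsto_const {Y : Type*} [TopologicalSpace Y] (y : Y) :
    ∀ k, SeqTendsto k (fun _ => y) y
  | 0 => fun _ => rfl
  | k + 1 => ⟨fun _ => y, fun _ => tendsto_const_nhds, seqTendsto_const y k⟩

/-- Here `k` counts the hidden widths still to be sent to infinity, `s` the layers already removed,
and `ℓ` the distance from the current first layer to the readout. Each limit lowers `k` and `ℓ` and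
raises `s`, keeping `s + ℓ` fixed. -/
theorem seqTendsto_readoutLaw {σ : ℝ → ℝ} {K : ℝ≥0} (hσ : LipschitzWith K σ) (hr : IsReadout r)
    {n₀ : ℕ} (x z : EuclideanSpace ℝ (Fin n₀)) (nL i : ℕ) {y : ProbabilityMeasure ℝ} (k : ℕ) :
    ∀ (ℓ s : ℕ) (F : (Fin k → ℕ) → ProbabilityMeasure ℝ), (ℓ < k ∨ ℓ = k ∧ i < nL) →
      (∀ m, (F m : Measure ℝ)
        = readoutLaw σ r (fun ℓ => widths n₀ m nL (ℓ + 1)) (pairLaw σ x z s) ℓ i) →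
      (y : Measure ℝ) = (pairLaw σ x z (s + ℓ)).map r → SeqTendsto k F y := by
  have hm := hσ.continuous.measurable
  induction k with
  | zero =>
    rintro ℓ s F (h | ⟨rfl, hi⟩) hF hy m
    · exact absurd h (Nat.not_lt_zero _)
    -- Only the output layer is left, and it already consists of i.i.d. limiting pairs.
    · refine Subtype.ext ((hF m).trans (Eq.trans ?_ hy.symm))
      exact map_coord_pi hr.measurable (by simpa [widths] using hi) _
  | succ k ih =>
    intro ℓ s F hℓ hF hy
    cases ℓ with
    | zero =>
      -- The readout is in the layer of width `N`: its law is exactly the limit once `N > i`, and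
      -- the remaining limits are of a constant.
      refine ⟨fun _ => y, fun m => tendsto_const_nhds.congr' ?_, seqTendsto_const y k⟩
      filter_upwards [eventually_gt_atTop i] with N hN
      refine Subtype.ext (hy.trans ((hF _).trans ?_).symm)
      rw [widths_cons]
      exact map_coord_pi hr.measurable hN _
    | succ ℓ =>
      have hp : ∀ m : Fin k → ℕ, IsProbabilityMeasure (readoutLaw σ r
          (fun ℓ => widths n₀ m nL (ℓ + 1)) (pairLaw σ x z (s + 1)) ℓ i) := fun m => by
        have := isProbabilityMeasure_layerLaw hm (fun ℓ => widths n₀ m nL (ℓ + 1))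
          (Measure.pi fun _ => pairLaw σ x z (s + 1)) ℓ
        exact Measure.isProbabilityMeasure_map (hr.measurable_coord _ i).aemeasurable
      refine ⟨fun m => ⟨_, hp m⟩, fun m => ?_, ih ℓ (s + 1) _ ?_ (fun m => rfl) ?_⟩
      · refine tendsto_readoutLaw hm hr (fun ℓ => widths n₀ m nL (ℓ + 1))
          (memLp_actHat hσ (pairLaw σ x z s)) (memLp_zHat hσ _) ℓ i (fun N => ?_) rfl
        rw [hF, widths_cons]
      · omega
      · rw [hy, add_right_comm, add_assoc]

end Readout

/-! ### The random network as a realization of the chain of layer laws. -/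

section RandomNetwork

variable {n : ℕ → ℕ} {σ : ℝ → ℝ}

/-- The pairs (preactivation, `z̃`) of layer `ℓ + 1`. -/
noncomputable def layerPairs (σ : ℝ → ℝ) (W : Weights n) (x z : Fin (n 0) → ℝ) (ℓ : ℕ) :
    Fin (n (ℓ + 1)) → EuclideanSpace ℝ (Fin 2) :=
  fun i => !₂[preact σ W x ℓ i, zTilde σ W x z ℓ i]

theorem layerPairs_zero (W : Weights n) (x z : Fin (n 0) → ℝ) :
    layerPairs σ W x z 0 = fun i => !₂[∑ j, W 0 i j * (1 / √(n 0 : ℝ) * x j),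
      ∑ j, W 0 i j * (1 / √(n 0 : ℝ) * z j)] := by
  funext i
  simp only [layerPairs, preact, zTilde, Pi.smul_apply, Matrix.mulVec, dotProduct, smul_eq_mul,
    Finset.mul_sum, mul_left_comm]

theorem zVec_eq (W : Weights n) (x z : Fin (n 0) → ℝ) (ℓ : ℕ) :
    zVec σ W x z ℓ = fun i => zHat σ (layerPairs σ W x z ℓ i) := by
  funext i
  simp [zVec, gate, Matrix.mulVec_diagonal, zHat, layerPairs]

theorem layerPairs_succ (W : Weights n) (x z : Fin (n 0) → ℝ) (ℓ : ℕ) :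
    layerPairs σ W x z (ℓ + 1) = nextPairs σ (layerPairs σ W x z ℓ) (W (ℓ + 1)) := by
  have h := zVec_eq (σ := σ) W x z ℓ
  rw [zVec] at h
  funext i
  simp only [layerPairs, preact, zTilde, h, nextPairs, Pi.smul_apply, Matrix.mulVec, dotProduct,
    smul_eq_mul, Finset.mul_sum, actHat, mul_left_comm (1 / √(n (ℓ + 1) : ℝ)), PiLp.toLp_apply,
    Matrix.cons_val_zero]

theorem layerPairs_congr {W W' : Weights n} (x z : Fin (n 0) → ℝ) {ℓ : ℕ}
    (h : ∀ j ≤ ℓ, W j = W' j) : layerPairs σ W x z ℓ = layerPairs σ W' x z ℓ := by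
  induction ℓ with
  | zero => rw [layerPairs_zero, layerPairs_zero, h 0 le_rfl]
  | succ ℓ ih =>
    rw [layerPairs_succ, layerPairs_succ, h _ le_rfl, ih fun j hj => h j (hj.trans ℓ.le_succ)]

theorem measurable_layerPairs (hσ : Measurable σ) {Ω : Type*} [MeasurableSpace Ω]
    {W : Ω → Weights n} (hW : ∀ ℓ i j, Measurable fun ω => W ω ℓ i j) (x z : Fin (n 0) → ℝ)
    (ℓ : ℕ) : Measurable fun ω => layerPairs σ (W ω) x z ℓ := by
  induction ℓ with
  | zero =>
    simp only [layerPairs_zero]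
    fun_prop
  | succ ℓ ih =>
    simp only [layerPairs_succ]
    have hA : Measurable fun ω i j => W ω (ℓ + 1) i j :=
      measurable_pi_lambda _ fun i => measurable_pi_lambda _ fun j => hW _ i j
    exact (measurable_nextPairs hσ).comp (ih.prodMk hA)

variable {Ω : Type*} [MeasurableSpace Ω] {P : Measure Ω} {L : ℕ} {W : Ω → Weights n}

theorem IsGaussianInit.hasLaw_weights (hW : IsGaussianInit L W P) {ℓ : ℕ} (hℓ : ℓ < L) :
    HasLaw (fun ω i j => W ω ℓ i j) (gaussianMatrix (n (ℓ + 1)) (n ℓ)) P := by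
  have hi := hW.indep.precomp (g := fun p : Fin (n (ℓ + 1)) × Fin (n ℓ) =>
      (⟨⟨ℓ, hℓ⟩, p⟩ : (ℓ : Fin L) × (Fin (n (ℓ + 1)) × Fin (n ℓ))))
    (by intro p q h; simpa using h)
  have hl := hi.hasLaw_pi (μ := fun _ => gaussianReal 0 1)
    fun p : Fin (n (ℓ + 1)) × Fin (n ℓ) => hW.hasLaw ℓ hℓ p.1 p.2
  have hc : HasLaw (MeasurableEquiv.curry (Fin (n (ℓ + 1))) (Fin (n ℓ)) ℝ)
      (gaussianMatrix (n (ℓ + 1)) (n ℓ))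
      (Measure.pi fun _ : Fin (n (ℓ + 1)) × Fin (n ℓ) => gaussianReal 0 1) := by
    refine ⟨(MeasurableEquiv.measurable _).aemeasurable, ?_⟩
    have := Measure.infinitePi_map_curry
      fun (_ : Fin (n (ℓ + 1))) (_ : Fin (n ℓ)) => gaussianReal 0 1
    simpa only [Measure.infinitePi_eq_pi, gaussianMatrix] using this
  exact hc.comp hl

/-- The pairs at index `ℓ` use only the weights of index at most `ℓ`, a set of entries disjoint from
those of index `ℓ + 1`. -/
theorem IsGaussianInit.indepFun_layerPairs (hσ : Measurable σ) (hW : IsGaussianInit L W P)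
    (x z : Fin (n 0) → ℝ) {ℓ : ℕ} (hℓ : ℓ + 1 < L) :
    IndepFun (fun ω => layerPairs σ (W ω) x z ℓ)
      (fun ω i j => W ω (ℓ + 1) i j) P := by
  classical
  set A : Finset ((ℓ : Fin L) × (Fin (n (ℓ + 1)) × Fin (n ℓ))) :=
    Finset.univ.filter fun e => (e.1 : ℕ) ≤ ℓ
  set B : Finset ((ℓ : Fin L) × (Fin (n (ℓ + 1)) × Fin (n ℓ))) :=
    Finset.univ.filter fun e => (e.1 : ℕ) = ℓ + 1
  have hAB : Disjoint A B := by
    refine Finset.disjoint_left.2 fun e h₁ h₂ => ?_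
    simp only [A, B, Finset.mem_filter] at h₁ h₂
    omega
  have hind := hW.indep.indepFun_finset₀ A B hAB fun e =>
    (hW.hasLaw e.1 e.1.2 e.2.1 e.2.2).aemeasurable
  -- Weights outside `A` are filled with `0`, which is harmless by `layerPairs_congr`.
  let V : (A → ℝ) → Weights n := fun t ℓ' i j =>
    if h : ℓ' < L ∧ ℓ' ≤ ℓ then t ⟨⟨⟨ℓ', h.1⟩, (i, j)⟩, by simp [A, h.2]⟩ else 0
  let ψ : (B → ℝ) → Fin (n (ℓ + 2)) → Fin (n (ℓ + 1)) → ℝ := fun t i j =>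
    t ⟨⟨⟨ℓ + 1, hℓ⟩, (i, j)⟩, by simp [B]⟩
  have hV : Measurable fun t => layerPairs σ (V t) x z ℓ :=
    measurable_layerPairs hσ (fun ℓ' i j => by
      simp only [V]
      split <;> fun_prop) x z ℓ
  have hψ : Measurable ψ := by
    simp only [ψ]
    fun_prop
  have e : (fun ω => layerPairs σ (W ω) x z ℓ)
      = (fun t => layerPairs σ (V t) x z ℓ) ∘ fun ω (e : A) => W ω e.1.1 e.1.2.1 e.1.2.2 := by
    funext ω
    refine layerPairs_congr x z fun ℓ' hℓ' => ?_
    ext i j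
    have : ℓ' < L ∧ ℓ' ≤ ℓ := ⟨by omega, hℓ'⟩
    simp [V, this]
  rw [e]
  exact hind.comp hV hψ

/-- Only laws matter from here on, so networks of different widths may be coupled arbitrarily on
`Ω`. -/
theorem IsGaussianInit.hasLaw_layerPairs (hσ : Measurable σ) [IsProbabilityMeasure P]
    (hW : IsGaussianInit L W P) (x z : EuclideanSpace ℝ (Fin (n 0))) {ℓ : ℕ} (hℓ : ℓ < L) :
    HasLaw (fun ω => layerPairs σ (W ω) x z ℓ)
      (layerLaw σ (fun ℓ => n (ℓ + 1)) (Measure.pi fun _ => pairLaw σ x z 0) ℓ) P := by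
  induction ℓ with
  | zero =>
    have h : HasLaw (fun (A : Fin (n 1) → Fin (n 0) → ℝ) i =>
        (!₂[∑ j, A i j * (1 / √(n 0 : ℝ) * x j), ∑ j, A i j * (1 / √(n 0 : ℝ) * z j)] :
          EuclideanSpace ℝ (Fin 2)))
        (Measure.pi fun _ => pairLaw σ x z 0) (gaussianMatrix (n 1) (n 0)) := by
      refine ⟨Measurable.aemeasurable (by fun_prop), ?_⟩
      rw [map_gaussianMatrix_eq_pi, ← pairCov_zero_eq_gramPair σ]
      rfl
    simp only [layerPairs_zero]
    exact h.comp (hW.hasLaw_weights hℓ)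
  | succ ℓ ih =>
    have := isProbabilityMeasure_layerLaw hσ (fun ℓ => n (ℓ + 1))
      (Measure.pi fun _ => pairLaw σ x z 0) ℓ
    have h₁ := ih (by omega)
    have h₂ := hW.hasLaw_weights hℓ
    have h := (indepFun_iff_hasLaw_prodMk_prod h₁ h₂).1 (hW.indepFun_layerPairs hσ x z hℓ)
    simp only [layerPairs_succ]
    exact (HasLaw.mk (measurable_nextPairs hσ).aemeasurable rfl).comp h

end RandomNetwork

/-! ### Convergence in distribution and the main theorem. -/

theorem seqTendstoInDistribution_readout {Ω : Type*} [MeasurableSpace Ω] {P : Measure Ω}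
    [IsProbabilityMeasure P] {σ : ℝ → ℝ} {K : ℝ≥0} (hσ : LipschitzWith K σ)
    {r : EuclideanSpace ℝ (Fin 2) → ℝ} (hr : IsReadout r)
    {k n₀ nL L : ℕ} (x z : EuclideanSpace ℝ (Fin n₀))
    {W : (m : Fin k → ℕ) → Ω → Weights (widths n₀ m nL)}
    (hW : ∀ m, IsGaussianInit L (W m) P) {ℓ i : ℕ} (hL : ℓ < L)
    (hℓ : ℓ < k ∨ ℓ = k ∧ i < nL) :
    SeqTendstoInDistribution
      (fun m ω => coord (fun j => r (layerPairs σ (W m ω) x z ℓ j)) i) P r (pairLaw σ x z ℓ) := by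
  have hlaw : ∀ m, HasLaw (fun ω => coord (fun j => r (layerPairs σ (W m ω) x z ℓ j)) i)
      (readoutLaw σ r (fun ℓ => widths n₀ m nL (ℓ + 1)) (pairLaw σ x z 0) ℓ i) P := fun m =>
    (HasLaw.mk (hr.measurable_coord _ i).aemeasurable rfl).comp
      ((hW m).hasLaw_layerPairs hσ.continuous.measurable x z hL)
  refine ⟨fun m => (hlaw m).aemeasurable, hr.measurable.aemeasurable, ?_⟩
  refine seqTendsto_readoutLaw hσ hr x z nL i k ℓ 0 _ hℓ (fun m => (hlaw m).map_eq) ?_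
  rw [zero_add]
  rfl

end WideNet

theorem proposition2 {Ω : Type*} [MeasurableSpace Ω] (P : Measure Ω) [IsProbabilityMeasure P]
    (σ : ℝ → ℝ) (K : ℝ≥0) (hσ : LipschitzWith K σ)
    (k n₀ nL : ℕ) (x z : EuclideanSpace ℝ (Fin n₀)) (hz : ‖z‖ = 1)
    (W : (m : Fin (k + 1) → ℕ) → Ω → WideNet.Weights (WideNet.widths n₀ m nL))
    (hW : ∀ m, WideNet.IsGaussianInit (k + 2) (W m) P) :
    (∀ ℓ : ℕ, (WideNet.pairCov σ x z ℓ).PosSemidef ∧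
      MemLp (WideNet.actHat σ) 2 (WideNet.pairLaw σ x z ℓ) ∧
      MemLp (WideNet.zHat σ) 2 (WideNet.pairLaw σ x z ℓ)) ∧
    (∀ ℓ < k + 1, ∀ i : ℕ,
      WideNet.SeqTendstoInDistribution
        (fun m ω => WideNet.coord (WideNet.zVec σ (W m ω) x z ℓ) i) P
        (WideNet.zHat σ) (WideNet.pairLaw σ x z ℓ)) ∧
    (∀ i : Fin nL,
      WideNet.SeqTendstoInDistribution
        (fun m ω => (WideNet.jacobian σ (W m ω) x (k + 1) *ᵥ z)
          (Fin.cast (WideNet.widths_last n₀ m nL).symm i)) P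
        (id : ℝ → ℝ)
        (gaussianReal 0 (∫ p, WideNet.zHat σ p ^ 2 ∂(WideNet.pairLaw σ x z k)).toNNReal)) := by
  refine ⟨fun ℓ => ⟨WideNet.pairCov_posSemidef hσ x z ℓ, WideNet.memLp_actHat hσ _,
    WideNet.memLp_zHat hσ _⟩, fun ℓ hℓ i => ?_, fun i => ?_⟩
  · have h := WideNet.seqTendstoInDistribution_readout hσ (WideNet.isReadout_zHat σ) x z hW
      (i := i) (by omega) (Or.inl hℓ)
    have hX : (fun (m : Fin (k + 1) → ℕ) ω => WideNet.coord (WideNet.zVec σ (W m ω) x z ℓ) i)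
        = fun m ω => WideNet.coord
          (fun j => WideNet.zHat σ (WideNet.layerPairs σ (W m ω) x z ℓ j)) i := by
      funext m ω
      exact congrArg (WideNet.coord · i) (WideNet.zVec_eq (W m ω) _ _ ℓ)
    rwa [hX]
  -- Index `k + 1` is the output layer `L = k + 2`; since `i < nL`, the default value of `coord`
  -- never occurs.
  · have h := WideNet.seqTendstoInDistribution_readout hσ WideNet.isReadout_snd x z hW
      (ℓ := k + 1) (i := i) (by omega) (Or.inr ⟨rfl, i.2⟩)
    have hX : (fun (m : Fin (k + 1) → ℕ) ω => (WideNet.jacobian σ (W m ω) x (k + 1) *ᵥ z)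
          (Fin.cast (WideNet.widths_last n₀ m nL).symm i))
        = fun m ω => WideNet.coord
          (fun j => WideNet.layerPairs σ (W m ω) x z (k + 1) j 1) i := by
      funext m ω
      have hi : (i : ℕ) < WideNet.widths n₀ m nL (k + 1 + 1) := by
        rw [WideNet.widths_last]; exact i.2
      exact (congrFun (WideNet.jacobian_mulVec σ (W m ω) _ _ (k + 1)) _).trans
        (WideNet.coord_of_lt (fun j => WideNet.layerPairs σ (W m ω) x z (k + 1) j 1) hi).symm
    rw [hX]
    refine ⟨h.aemeasurable, aemeasurable_id,
      (congrArg (WideNet.SeqTendsto (Y := ProbabilityMeasure ℝ) (k + 1) _) (Subtype.ext ?_)).mpr h.tendsto⟩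
    change Measure.map id _ = Measure.map _ _
    rw [Measure.map_id]
    -- The second marginal has variance `pairCov σ x z (k + 1) 1 1`, which is by definition the
    -- second moment of `zHat σ` under `pairLaw σ x z k`.
    exact (measurePreserving_eval_multivariateGaussian (μ := 0)
      (WideNet.pairCov_posSemidef hσ x z (k + 1)) (i := 1)).map_eq.symm
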